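/- Let $[n]=\{1,\dots,n\}$. A \emph{code} is a set $\mathcal C\subseteq 2^{[n]}$, for some $n\ge 0$. It is \emph{convex} if for some $d$ there are a (possibly empty) convex open set $X\subseteq\mathbb R^d$ and convex open sets $U_1,\dots,U_n\subseteq X$ such that $\mathcal C$ is the set of all $\sigma\subseteq[n]$ with $\bigcap_{i\in\sigma}U_i\setminus\bigcup_{j\notin\sigma}U_j\neq\emptyset$, where the empty intersection is $X$. A \emph{trunk} in $\mathcal C$ is a subset of $\mathcal C$ that is empty or of the form $\{c\in\mathcal C:\sigma\subseteq c\}$ with $\sigma\subseteq[n]$. A \emph{morphism} $f:\mathcal C\to\mathcal D$ of codes is a function such that the preimage of every trunk in $\mathcal D$ is a trunk in $\mathcal C$; it is an \emph{isomorphism} if it has an inverse function that is a morphism. A code $\mathcal C$ is \emph{minimally non-convex} if $\mathcal C$ is not convex, but every image $f(\mathcal C)$ of $\mathcal C$ under a morphism that is not isomorphic to $\mathcal C$ is convex, and every trunk $T\subsetneq\mathcal C$ in $\mathcal C$ is a convex code. Write $\mathcal D\le\mathcal C$ if $\mathcal D$ can be obtained from $\mathcal C$ by finitely many operations, each of which replaces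 a code by its image under a morphism or by one of its trunks. A simplicial complex $\Delta\subseteq 2^{[n]}$ is a family that contains $\emptyset$ and is closed under taking subsets. A nonempty face $\tau$ is \emph{free} if it is contained in a unique facet $\sigma$ and $\tau\ne\sigma$; a \emph{collapse} removes all faces that contain a given free face. $\Delta$ is \emph{collapsible} if some finite sequence of collapses takes it to a single vertex. \textbf{Proposition.} (i) Let $\Delta\subseteq 2^{[n]}$ be a non-collapsible simplicial complex with at least one vertex. Then the code $\Delta\setminus\{\emptyset\}$ is minimally non-convex. (ii) There are infinitely many minimally non-convex codes of the form $\Delta\setminus\{\emptyset\}$, with $\Delta$ as in (i), that are pairwise incomparable with respect to $\le$ (in particular, pairwise non-isomorphic). -/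

import Mathlib

/-- A combinatorial code: a set of codewords in the Boolean lattice of subsets of `Fin n`. -/
structure CombCode where
  /-- the number of neurons -/
  n : ℕ
  /-- the codewords -/
  words : Set (Finset (Fin n))

namespace CombCode

/-- The trunk of `σ` in `C`: all codewords that contain `σ`. -/
def trunk (C : CombCode) (σ : Finset (Fin C.n)) : Set (Finset (Fin C.n)) :=
  {c | c ∈ C.words ∧ σ ⊆ c}

/-- A trunk in `C` is the empty set or the trunk of some `σ`. -/
def IsTrunk (C : CombCode) (T : Set (Finset (Fin C.n))) : Prop :=
  T = ∅ ∨ ∃ σ : Finset (Fin C.n), T = C.trunk σ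

/-- A function between codes is a morphism if preimages of trunks are trunks. -/
def IsMorphism {C D : CombCode} (f : C.words → D.words) : Prop :=
  ∀ T : Set (Finset (Fin D.n)), D.IsTrunk T →
    C.IsTrunk (Subtype.val '' {c : C.words | (f c : Finset (Fin D.n)) ∈ T})

/-- Two codes are isomorphic if there is a morphism with an inverse function that is a morphism. -/
def Isomorphic (C D : CombCode) : Prop :=
  ∃ (f : C.words → D.words) (g : D.words → C.words),
    IsMorphism f ∧ IsMorphism g ∧ Function.LeftInverse g f ∧ Function.RightInverse g f

/-- The image of a function between codes, as a code on the neurons of the target. -/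
def image {C D : CombCode} (f : C.words → D.words) : CombCode :=
  ⟨D.n, Set.range fun c => (f c : Finset (Fin D.n))⟩

/-- The code of sets `U i` in the ambient space `X`; the empty intersection is `X`. -/
def ofCover {n : ℕ} {E : Type*} (U : Fin n → Set E) (X : Set E) : CombCode :=
  ⟨n, {σ | ((X ∩ ⋂ i ∈ σ, U i) \ ⋃ j ∉ σ, U j).Nonempty}⟩

/-- A code is convex if it is the code of convex open subsets `U i` of a convex open set `X` in
some Euclidean space. -/
def IsConvex (C : CombCode) : Prop :=
  ∃ (d : ℕ) (X : Set (EuclideanSpace ℝ (Fin d)))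
    (U : Fin C.n → Set (EuclideanSpace ℝ (Fin d))),
    IsOpen X ∧ Convex ℝ X ∧ (∀ i, U i ⊆ X ∧ IsOpen (U i) ∧ Convex ℝ (U i)) ∧ ofCover U X = C

/-- A code is minimally non-convex if it is not convex, but all its images that are not isomorphic
to it are convex and all its proper trunks are convex. -/
def MinimallyNonConvex (C : CombCode) : Prop :=
  ¬ C.IsConvex ∧
  (∀ (D : CombCode) (f : C.words → D.words), IsMorphism f →
    ¬ Isomorphic (image f) C → (image f).IsConvex) ∧
  (∀ T : Set (Finset (Fin C.n)), C.IsTrunk T → T ≠ C.words → (CombCode.mk C.n T).IsConvex)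

/-- `D` arises from `C` by one operation: taking the image under some morphism, or a trunk. -/
def Operation (C D : CombCode) : Prop :=
  (∃ (E : CombCode) (f : C.words → E.words), IsMorphism f ∧ D = image f) ∨
  (∃ T : Set (Finset (Fin C.n)), C.IsTrunk T ∧ D = ⟨C.n, T⟩)

/-- The order on (isomorphism classes of) codes: some series of operations takes `C` to `D`. -/
def Below (D C : CombCode) : Prop :=
  Relation.ReflTransGen Operation C D

end CombCode

/-- A (finite, abstract) simplicial complex with vertices among `Fin n`: a family of sets that is
closed under taking subsets and contains the empty face. -/
def IsSimplicialComplex {n : ℕ} (Δ : Set (Finset (Fin n))) : Prop :=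
  ∅ ∈ Δ ∧ IsLowerSet Δ

/-- A collapse: `τ` is a nonempty free face of `Δ`, that is, it lies in a unique facet `σ`, and
`τ ≠ σ`; all faces that contain `τ` are removed. -/
def CollapseStep {n : ℕ} (Δ Γ : Set (Finset (Fin n))) : Prop :=
  ∃ τ σ : Finset (Fin n), τ.Nonempty ∧ τ ⊂ σ ∧ σ ∈ Δ ∧ (∀ γ ∈ Δ, τ ⊆ γ → γ ⊆ σ) ∧
    Γ = {γ | γ ∈ Δ ∧ ¬ τ ⊆ γ}

/-- A complex is collapsible if a sequence of collapses takes it to a single vertex. -/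
def IsCollapsible {n : ℕ} (Δ : Set (Finset (Fin n))) : Prop :=
  ∃ v : Fin n, Relation.ReflTransGen CollapseStep Δ {∅, {v}}

/-! If `Δ \ {∅}` is the code of convex open sets in `X`, then the missing empty codeword makes these
sets cover `X`, and `Δ` is their nerve. Such a nerve is collapsible (`isCollapsible_nerve`): send
each face to the point nearest the origin in the closure of its intersection, and match faces by
toggling a vertex whose open set contains this point. Toggling does not move the point, as being
nearest is a local property of convex sets.

Minimality rests on `Δ` itself being convex (`isConvex_of_isSimplicialComplex`). A morphism on `Δ \
{∅}` that is not an isomorphism onto its image fails to detect some vertex `v`; sending `∅` where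
`{v}` goes then exhibits the image as one of `Δ`. Proper trunks are trunks of `Δ` too.

For the antichain, boundaries of simplices have no free faces, and a non-convex code below a
minimally non-convex one is isomorphic to it, so counting codewords suffices. -/

open scoped RealInnerProductSpace

/-! ### Collapses from matchings -/

section Collapse

/-- A complex is collapsible if its faces are matched by adding or removing a vertex `k (p F)`, where
`p` is invariant under the matching and a monotone function of `p` separates the values of `p` on
nested faces. -/
theorem isCollapsible_of_matching {n : ℕ} {P : Type*} (p : Finset (Fin n) → P) (m : P → ℝ)
    (k : P → Fin n) (Δ : Set (Finset (Fin n))) (hΔ : IsSimplicialComplex Δ)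
    (hmono : ∀ F G, F ⊆ G → G ∈ Δ → m (p F) ≤ m (p G))
    (heq : ∀ F G, F ⊆ G → G ∈ Δ → m (p F) = m (p G) → p F = p G)
    (hins : ∀ F ∈ Δ, insert (k (p F)) F ∈ Δ ∧ p (insert (k (p F)) F) = p F)
    (hera : ∀ F ∈ Δ, p (F.erase (k (p F))) = p F) : IsCollapsible Δ := by
  induction hN : Δ.ncard using Nat.strong_induction_on generalizing Δ with
  | _ N ih =>
  subst hN
  -- Maximality of `m` forces every face above `τ` to share its value of `p`; maximal size away from
  -- `κ` then leaves only `τ` and `insert κ τ`. So `τ` is free.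
  obtain ⟨F₀, hF₀, hmax⟩ := Set.exists_max_image Δ
    (fun F => toLex (m (p F), (F.erase (k (p F))).card)) Δ.toFinite ⟨∅, hΔ.1⟩
  set κ := k (p F₀) with hκ
  set τ := F₀.erase κ with hτ
  have hpτ : p τ = p F₀ := hera F₀ hF₀
  have hτΔ : τ ∈ Δ := hΔ.2 (Finset.erase_subset _ _) hF₀
  have hκτ : κ ∉ τ := Finset.notMem_erase _ _
  have hσ := hins τ hτΔ
  rw [hpτ, ← hκ] at hσ
  have htop : ∀ γ ∈ Δ, τ ⊆ γ → p γ = p F₀ ∧ γ ⊆ insert κ τ := by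
    intro γ hγ hτγ
    have h1 := hmax γ hγ
    rw [Prod.Lex.toLex_le_toLex] at h1
    have h2 := hmono τ γ hτγ hγ
    rw [hpτ] at h2
    have h3 : m (p γ) = m (p F₀) := by
      rcases h1 with h1 | h1
      · exact absurd h1 (not_lt.mpr h2)
      · exact h1.1
    have h4 : p γ = p F₀ := by
      rw [← hpτ]; exact (heq τ γ hτγ hγ (by rw [hpτ, h3])).symm
    refine ⟨h4, ?_⟩
    have h5 : (γ.erase κ).card ≤ τ.card := by
      rcases h1 with h1 | h1
      · exact absurd h1 (not_lt.mpr h2)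
      · have := h1.2
        simp only [h4] at this
        exact this
    have h6 : τ ⊆ γ.erase κ := Finset.subset_erase.mpr ⟨hτγ, hκτ⟩
    rw [Finset.eq_of_subset_of_card_le h6 h5]
    exact Finset.subset_insert_iff.mpr subset_rfl
  rcases τ.eq_empty_or_nonempty with h0 | hne
  · refine ⟨κ, ?_⟩
    have : Δ = {∅, {κ}} := by
      ext γ
      simp only [Set.mem_insert_iff, Set.mem_singleton_iff]
      constructor
      · intro hγ
        have := (htop γ hγ (by simp [h0])).2
        rw [h0] at this
        exact Finset.subset_singleton_iff.mp (by simpa using this)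
      · rintro (rfl | rfl)
        · exact hΔ.1
        · have := hσ.1
          rw [h0] at this
          simpa using this
    rw [this]
  · set Γ : Set (Finset (Fin n)) := {γ | γ ∈ Δ ∧ ¬ τ ⊆ γ} with hΓ
    have hΓΔ : Γ ⊆ Δ := fun γ h => h.1
    have hlt : Γ.ncard < Δ.ncard := by
      refine Set.ncard_lt_ncard ⟨hΓΔ, fun h => ?_⟩ Δ.toFinite
      exact (h hτΔ).2 subset_rfl
    obtain ⟨v, hv⟩ := ih _ hlt Γ
      ⟨⟨hΔ.1, fun h => hne.ne_empty (Finset.subset_empty.mp h)⟩,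
        fun a b hba ha => ⟨hΔ.2 hba ha.1, fun h => ha.2 (h.trans hba)⟩⟩
      (fun F G hFG hG => hmono F G hFG hG.1)
      (fun F G hFG hG => heq F G hFG hG.1)
      -- The matching survives: the collapse removes exactly the matched pair `τ`, `insert κ τ`.
      (fun F hF => ⟨⟨(hins F hF.1).1, fun h => hF.2 (by
        have h1 := (htop _ (hins F hF.1).1 h).1
        rw [(hins F hF.1).2] at h1
        rw [h1, ← hκ] at h
        exact (Finset.subset_insert_iff_of_notMem hκτ).mp h)⟩, (hins F hF.1).2⟩)
      (fun F hF => hera F hF.1) rfl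
    refine ⟨v, Relation.ReflTransGen.head ⟨τ, insert κ τ, hne, Finset.ssubset_insert hκτ, hσ.1,
      fun γ h h' => (htop γ h h').2, hΓ⟩ hv⟩

end Collapse

/-! ### Nearest points and nerves of convex covers -/

section Projection

variable {E : Type*} [NormedAddCommGroup E] [InnerProductSpace ℝ E]

/-- `p` is the point of the closure of `S` that is nearest to the origin, in terms of the variational
inequality. -/
def IsNearestPoint (S : Set E) (p : E) : Prop :=
  p ∈ closure S ∧ ∀ w ∈ closure S, 0 ≤ ⟪p, w - p⟫

theorem exists_isNearestPoint {S : Set E} (hS : S.Nonempty) (hconv : Convex ℝ S)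
    (hcomp : IsComplete (closure S)) : ∃ p, IsNearestPoint S p := by
  obtain ⟨p, hp, h⟩ := exists_norm_eq_iInf_of_complete_convex hS.closure hcomp hconv.closure 0
  refine ⟨p, hp, fun w hw => ?_⟩
  have := (norm_eq_iInf_iff_real_inner_le_zero hconv.closure hp).mp h w hw
  rw [zero_sub, inner_neg_left] at this
  linarith

/-- The nearest point of a subset is farther away, by Pythagoras. -/
theorem IsNearestPoint.norm_sq_add_le {S T : Set E} {p q : E} (hp : IsNearestPoint S p)
    (hq : IsNearestPoint T q) (hTS : T ⊆ S) : ‖p‖ ^ 2 + ‖q - p‖ ^ 2 ≤ ‖q‖ ^ 2 := by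
  have h := hp.2 q (closure_mono hTS hq.1)
  have h2 : ‖p + (q - p)‖ ^ 2 = ‖p‖ ^ 2 + 2 * ⟪p, q - p⟫ + ‖q - p‖ ^ 2 := norm_add_sq_real _ _
  rw [add_sub_cancel] at h2
  linarith

theorem IsNearestPoint.norm_le {S T : Set E} {p q : E} (hp : IsNearestPoint S p)
    (hq : IsNearestPoint T q) (hTS : T ⊆ S) : ‖p‖ ≤ ‖q‖ := by
  have := hp.norm_sq_add_le hq hTS
  exact le_of_sq_le_sq (by nlinarith [sq_nonneg ‖q - p‖]) (norm_nonneg _)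

theorem IsNearestPoint.eq_of_norm_eq {S T : Set E} {p q : E} (hp : IsNearestPoint S p)
    (hq : IsNearestPoint T q) (hTS : T ⊆ S) (h : ‖p‖ = ‖q‖) : p = q := by
  have := hp.norm_sq_add_le hq hTS
  rw [h] at this
  have h0 : ‖q - p‖ ^ 2 = 0 := le_antisymm (by linarith) (sq_nonneg _)
  exact (sub_eq_zero.mp (norm_eq_zero.mp (pow_eq_zero_iff two_ne_zero |>.mp h0))).symm

theorem IsNearestPoint.eq {S : Set E} {p q : E} (hp : IsNearestPoint S p)
    (hq : IsNearestPoint S q) : p = q :=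
  hp.eq_of_norm_eq hq subset_rfl
    (le_antisymm (hp.norm_le hq subset_rfl) (hq.norm_le hp subset_rfl))

/-- Being a nearest point of a convex set is a local property. -/
theorem isNearestPoint_inter_iff {S U : Set E} {p : E} (hS : Convex ℝ S) (hU : IsOpen U)
    (hp : p ∈ U) : IsNearestPoint (S ∩ U) p ↔ IsNearestPoint S p := by
  constructor
  · rintro ⟨h1, h2⟩
    have hpS := closure_mono Set.inter_subset_left h1
    refine ⟨hpS, fun w hw => ?_⟩
    -- A short step from `p` towards `w` stays in `U`, and the inequality there is `t` times the
    -- desired one.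
    have hc : Filter.Tendsto (fun t : ℝ => p + t • (w - p)) (nhdsWithin 0 (Set.Ioi 0)) (nhds p) := by
      have : Continuous fun t : ℝ => p + t • (w - p) := by fun_prop
      have h := this.tendsto 0
      simp only [zero_smul, add_zero] at h
      exact h.mono_left nhdsWithin_le_nhds
    have h1' : ∀ᶠ t : ℝ in nhdsWithin 0 (Set.Ioi 0), t ∈ Set.Ioo (0 : ℝ) 1 :=
      Ioo_mem_nhdsGT one_pos
    obtain ⟨t, htU, ht0, ht1⟩ := ((hc.eventually (hU.mem_nhds hp)).and h1').exists
    have hmem : p + t • (w - p) ∈ closure S :=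
      hS.closure.add_smul_sub_mem hpS hw ⟨ht0.le, ht1.le⟩
    have := h2 _ (by rw [Set.inter_comm]; exact hU.inter_closure ⟨htU, hmem⟩)
    rw [add_sub_cancel_left, inner_smul_right] at this
    exact nonneg_of_mul_nonneg_right this ht0
  · rintro ⟨h1, h2⟩
    exact ⟨by rw [Set.inter_comm]; exact hU.inter_closure ⟨hp, h1⟩,
      fun w hw => h2 w (closure_mono Set.inter_subset_left hw)⟩

/-- The nerve of a cover of a compact convex set by convex open sets is collapsible. -/
theorem isCollapsible_nerve_of_isCompact {n : ℕ} {K : Set E} (hK : IsCompact K) (hKc : Convex ℝ K)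
    (hne : K.Nonempty) {U : Fin n → Set E} (hUo : ∀ i, IsOpen (U i)) (hUc : ∀ i, Convex ℝ (U i))
    (hcov : K ⊆ ⋃ i, U i) : IsCollapsible {F | (K ∩ ⋂ i ∈ F, U i).Nonempty} := by
  classical
  set A : Finset (Fin n) → Set E := fun F => K ∩ ⋂ i ∈ F, U i with hA
  have hAc : ∀ F, Convex ℝ (A F) := fun F =>
    hKc.inter (convex_iInter fun i => convex_iInter fun _ => hUc i)
  have hAmono : ∀ {F G}, F ⊆ G → A G ⊆ A F := fun h =>
    Set.inter_subset_inter_right _ (Set.biInter_subset_biInter_left h)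
  have hcl : ∀ F, closure (A F) ⊆ K := fun F =>
    closure_minimal Set.inter_subset_left hK.isClosed
  have hex : ∀ F, (A F).Nonempty → ∃ p, IsNearestPoint (A F) p := fun F hF =>
    exists_isNearestPoint hF (hAc F) (hK.of_isClosed_subset isClosed_closure (hcl F)).isComplete
  choose! p hp using hex
  have hk : ∀ x ∈ K, ∃ i, x ∈ U i := fun x hx => Set.mem_iUnion.mp (hcov hx)
  obtain ⟨x₀, hx₀⟩ := hne
  obtain ⟨i₀, -⟩ := hk x₀ hx₀
  have : Nonempty (Fin n) := ⟨i₀⟩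
  choose! k hk using hk
  have hkU : ∀ F, (A F).Nonempty → p F ∈ U (k (p F)) := fun F hF => hk _ (hcl F (hp F hF).1)
  have hins : ∀ F i, A (insert i F) = A F ∩ U i := by
    intro F i
    simp only [hA, Finset.set_biInter_insert]
    rw [Set.inter_assoc, Set.inter_comm (U i)]
  refine isCollapsible_of_matching p (fun x => ‖x‖) k _ ⟨?_, ?_⟩ ?_ ?_ ?_ ?_
  · exact ⟨x₀, hx₀, by simp⟩
  · exact fun a b hba ha => Set.Nonempty.mono (hAmono hba) ha
  · exact fun F G hFG hG => (hp F (hG.mono (hAmono hFG))).norm_le (hp G hG) (hAmono hFG)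
  · exact fun F G hFG hG => (hp F (hG.mono (hAmono hFG))).eq_of_norm_eq (hp G hG) (hAmono hFG)
  · intro F hF
    have h := (isNearestPoint_inter_iff (hAc F) (hUo _) (hkU F hF)).mpr (hp F hF)
    rw [← hins] at h
    have hne' : (A (insert (k (p F)) F)).Nonempty := closure_nonempty_iff.mp ⟨_, h.1⟩
    exact ⟨hne', (hp _ hne').eq h⟩
  · intro F hF
    by_cases hm : k (p F) ∈ F
    · have h := hp F hF
      have hFe : A F = A (F.erase (k (p F))) ∩ U (k (p F)) := by
        rw [← hins, Finset.insert_erase hm]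
      rw [hFe] at h
      exact (hp _ (hF.mono (hAmono (Finset.erase_subset _ _)))).eq
        ((isNearestPoint_inter_iff (hAc _) (hUo _) (hkU F hF)).mp h)
    · rw [Finset.erase_eq_of_notMem hm]

/-- The nerve of a cover of a convex set by convex open sets is collapsible. -/
theorem isCollapsible_nerve {n : ℕ} {X : Set E} (hX : Convex ℝ X) (hne : X.Nonempty)
    {U : Fin n → Set E} (hUo : ∀ i, IsOpen (U i)) (hUc : ∀ i, Convex ℝ (U i))
    (hcov : X ⊆ ⋃ i, U i) : IsCollapsible {F | (X ∩ ⋂ i ∈ F, U i).Nonempty} := by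
  set Δ : Set (Finset (Fin n)) := {F | (X ∩ ⋂ i ∈ F, U i).Nonempty} with hΔ
  have hmem : ∀ F : Δ, ∃ x, x ∈ X ∩ ⋂ i ∈ F.1, U i := fun F => F.2
  choose x hx using hmem
  -- The hull of one witness per face is compact and has the same nerve.
  set K := convexHull ℝ (Set.range x) with hK
  have hKX : K ⊆ X := convexHull_min (by rintro _ ⟨F, rfl⟩; exact (hx F).1) hX
  have hxK : ∀ F, x F ∈ K := fun F => subset_convexHull ℝ _ ⟨F, rfl⟩
  have h0 : ∅ ∈ Δ := by
    obtain ⟨y, hy⟩ := hne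
    exact ⟨y, hy, by simp⟩
  have hEq : Δ = {F | (K ∩ ⋂ i ∈ F, U i).Nonempty} := by
    ext F
    exact ⟨fun hF => ⟨x ⟨F, hF⟩, hxK _, (hx ⟨F, hF⟩).2⟩,
      fun h => h.mono (Set.inter_subset_inter_left _ hKX)⟩
  rw [hEq]
  exact isCollapsible_nerve_of_isCompact ((Set.finite_range x).isCompact_convexHull ℝ)
    (convex_convexHull ℝ _) ⟨_, hxK ⟨∅, h0⟩⟩ hUo hUc (hKX.trans hcov)

end Projection

/-! ### Convex codes, morphisms and trunks -/

namespace CombCode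

theorem mem_ofCover {n : ℕ} {E : Type*} {U : Fin n → Set E} {X : Set E} {σ : Finset (Fin n)} :
    σ ∈ (ofCover U X).words ↔ ∃ x ∈ X, ∀ i, i ∈ σ ↔ x ∈ U i := by
  constructor
  · rintro ⟨x, ⟨hX, h1⟩, h2⟩
    simp only [Set.mem_iInter, Set.mem_iUnion, not_exists] at h1 h2
    exact ⟨x, hX, fun i => ⟨h1 i, fun h => by_contra fun hi => h2 i hi h⟩⟩
  · rintro ⟨x, hX, h⟩
    refine ⟨x, ⟨hX, ?_⟩, ?_⟩
    · simp only [Set.mem_iInter]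
      exact fun i hi => (h i).mp hi
    · simp only [Set.mem_iUnion, not_exists]
      exact fun i hi hx => hi ((h i).mpr hx)

theorem isConvex_mk_iff {n : ℕ} {W : Set (Finset (Fin n))} :
    (CombCode.mk n W).IsConvex ↔
      ∃ (d : ℕ) (X : Set (EuclideanSpace ℝ (Fin d))) (U : Fin n → Set (EuclideanSpace ℝ (Fin d))),
        IsOpen X ∧ Convex ℝ X ∧ (∀ i, U i ⊆ X ∧ IsOpen (U i) ∧ Convex ℝ (U i)) ∧
          ∀ σ, σ ∈ W ↔ ∃ x ∈ X, ∀ i, i ∈ σ ↔ x ∈ U i := by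
  refine exists_congr fun d => exists_congr fun X => exists_congr fun U => and_congr_right fun _ =>
    and_congr_right fun _ => and_congr_right fun _ => ?_
  constructor
  · intro h σ
    unfold ofCover at h
    injection h with _ h
    rw [← h]
    exact mem_ofCover
  · intro h
    have : (ofCover U X).words = W := Set.ext fun σ => mem_ofCover.trans (h σ).symm
    rw [← this]
    rfl

/-- Trunks of single neurons suffice, since every trunk is an intersection of these and trunks are
closed under intersection. -/
theorem isMorphism_iff {C D : CombCode} {f : C.words → D.words} :
    IsMorphism f ↔ ∀ j : Fin D.n, (∀ c, j ∉ (f c).1) ∨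
      ∃ τ : Finset (Fin C.n), ∀ c, j ∈ (f c).1 ↔ τ ⊆ c.1 := by
  classical
  constructor
  · intro h j
    rcases h (D.trunk {j}) (Or.inr ⟨_, rfl⟩) with h | ⟨τ, h⟩
    · left
      intro c hc
      rw [Set.image_eq_empty] at h
      have : c ∈ (∅ : Set C.words) := h ▸ ⟨(f c).2, Finset.singleton_subset_iff.mpr hc⟩
      exact this
    · right
      refine ⟨τ, fun c => ⟨fun hc => ?_, fun hc => ?_⟩⟩
      · have : c.1 ∈ C.trunk τ := h ▸ ⟨c, ⟨(f c).2, Finset.singleton_subset_iff.mpr hc⟩, rfl⟩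
        exact this.2
      · have : c.1 ∈ C.trunk τ := ⟨c.2, hc⟩
        rw [← h] at this
        obtain ⟨c', hc', he⟩ := this
        obtain rfl := Subtype.ext he
        exact Finset.singleton_subset_iff.mp hc'.2
  · rintro h T (rfl | ⟨σ, rfl⟩)
    · left
      simp
    · by_cases hσ : ∃ j ∈ σ, ∀ c, j ∉ (f c).1
      · obtain ⟨j, hj, hc⟩ := hσ
        left
        rw [Set.image_eq_empty, Set.eq_empty_iff_forall_notMem]
        exact fun c h => hc c (h.2 hj)
      · push Not at hσ
        have h' : ∀ j, ∃ τ : Finset (Fin C.n), j ∈ σ → ∀ c, j ∈ (f c).1 ↔ τ ⊆ c.1 := by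
          intro j
          by_cases hj : j ∈ σ
          · rcases h j with h | ⟨τ, h⟩
            · obtain ⟨c, hc⟩ := hσ j hj
              exact absurd hc (h c)
            · exact ⟨τ, fun _ => h⟩
          · exact ⟨∅, fun h => absurd h hj⟩
        choose τ hτ using h'
        right
        refine ⟨σ.biUnion τ, ?_⟩
        have key : ∀ c : C.words, σ ⊆ (f c).1 ↔ σ.biUnion τ ⊆ c.1 := fun c => by
          rw [Finset.biUnion_subset]
          exact ⟨fun h j hj => (hτ j hj c).mp (h hj), fun h j hj => (hτ j hj c).mpr (h j hj)⟩
        ext c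
        constructor
        · rintro ⟨c, hc, rfl⟩
          exact ⟨c.2, (key c).mp hc.2⟩
        · rintro ⟨hc, hs⟩
          exact ⟨⟨c, hc⟩, ⟨(f _).2, (key ⟨c, hc⟩).mpr hs⟩, rfl⟩

theorem IsMorphism.comp {C D E : CombCode} {g : D.words → E.words} {f : C.words → D.words}
    (hg : IsMorphism g) (hf : IsMorphism f) : IsMorphism (g ∘ f) := by
  intro T hT
  have := hf _ (hg T hT)
  convert this using 2
  ext c
  simp

/-- Maps of codes that are given by trunks preserve convexity. -/
theorem IsConvex.map {n m : ℕ} {W : Set (Finset (Fin n))} (hW : (CombCode.mk n W).IsConvex)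
    (g : Finset (Fin n) → Finset (Fin m))
    (hg : ∀ j, (∀ c ∈ W, j ∉ g c) ∨ ∃ τ, ∀ c ∈ W, j ∈ g c ↔ τ ⊆ c) :
    (CombCode.mk m (g '' W)).IsConvex := by
  classical
  obtain ⟨d, X, U, hXo, hXc, hU, hWU⟩ := isConvex_mk_iff.mp hW
  have hV : ∀ j, ∃ V : Set (EuclideanSpace ℝ (Fin d)), (V ⊆ X ∧ IsOpen V ∧ Convex ℝ V) ∧
      ∀ c ∈ W, ∀ x ∈ X, (∀ i, i ∈ c ↔ x ∈ U i) → (j ∈ g c ↔ x ∈ V) := by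
    intro j
    rcases hg j with h | ⟨τ, h⟩
    · refine ⟨∅, ⟨Set.empty_subset _, isOpen_empty, convex_empty⟩, fun c hc x _ _ => ?_⟩
      simp [h c hc]
    · refine ⟨X ∩ ⋂ i ∈ τ, U i, ⟨Set.inter_subset_left,
        hXo.inter (isOpen_biInter_finset fun i _ => (hU i).2.1),
        hXc.inter (convex_iInter fun i => convex_iInter fun _ => (hU i).2.2)⟩,
        fun c hc x hx hcx => ?_⟩
      rw [h c hc]
      simp only [Set.mem_inter_iff, hx, Set.mem_iInter, true_and]
      exact forall₂_congr fun i _ => hcx i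
  choose V hV hgV using hV
  refine isConvex_mk_iff.mpr ⟨d, X, V, hXo, hXc, hV, fun σ => ?_⟩
  constructor
  · rintro ⟨c, hc, rfl⟩
    obtain ⟨x, hx, hcx⟩ := (hWU c).mp hc
    exact ⟨x, hx, fun j => hgV j c hc x hx hcx⟩
  · rintro ⟨x, hx, hσ⟩
    have hcx : ∀ i, i ∈ Finset.univ.filter (fun i => x ∈ U i) ↔ x ∈ U i := by simp
    have hc := (hWU _).mpr ⟨x, hx, hcx⟩
    refine ⟨_, hc, ?_⟩
    ext j
    rw [hσ j, hgV j _ hc x hx hcx]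

theorem IsConvex.image {C D : CombCode} (hC : C.IsConvex) {f : C.words → D.words}
    (hf : IsMorphism f) : (image f).IsConvex := by
  classical
  set g : Finset (Fin C.n) → Finset (Fin D.n) := fun c =>
    if h : c ∈ C.words then (f ⟨c, h⟩).1 else ∅ with hgdef
  have hgf : ∀ c (h : c ∈ C.words), g c = (f ⟨c, h⟩).1 := fun c h => dif_pos h
  have hW : CombCode.image f = ⟨D.n, g '' C.words⟩ := by
    unfold CombCode.image
    congr 1
    ext σ
    constructor
    · rintro ⟨c, rfl⟩
      exact ⟨c.1, c.2, hgf _ c.2⟩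
    · rintro ⟨c, hc, rfl⟩
      exact ⟨⟨c, hc⟩, (hgf c hc).symm⟩
  rw [hW]
  refine IsConvex.map hC g fun j => (isMorphism_iff.mp hf j).imp ?_ ?_
  · intro h c hc
    rw [hgf c hc]
    exact h _
  · rintro ⟨τ, h⟩
    refine ⟨τ, fun c hc => ?_⟩
    rw [hgf c hc]
    exact h ⟨c, hc⟩

theorem isConvex_empty (n : ℕ) : (CombCode.mk n ∅).IsConvex :=
  isConvex_mk_iff.mpr ⟨0, ∅, fun _ => ∅, isOpen_empty, convex_empty,
    fun _ => ⟨subset_rfl, isOpen_empty, convex_empty⟩, fun σ => by simp⟩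

theorem IsConvex.isTrunk {C : CombCode} (hC : C.IsConvex) {T : Set (Finset (Fin C.n))}
    (hT : C.IsTrunk T) : (CombCode.mk C.n T).IsConvex := by
  rcases hT with rfl | ⟨σ, rfl⟩
  · exact isConvex_empty _
  · obtain ⟨d, X, U, hXo, hXc, hU, hWU⟩ := isConvex_mk_iff.mp hC
    have hSo : IsOpen (⋂ i ∈ σ, U i) := isOpen_biInter_finset fun i _ => (hU i).2.1
    have hSc : Convex ℝ (⋂ i ∈ σ, U i) :=
      convex_iInter fun i => convex_iInter fun _ => (hU i).2.2
    refine isConvex_mk_iff.mpr ⟨d, X ∩ ⋂ i ∈ σ, U i, fun i => U i ∩ ⋂ i ∈ σ, U i,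
      hXo.inter hSo, hXc.inter hSc, fun i => ⟨Set.inter_subset_inter_left _ (hU i).1,
        (hU i).2.1.inter hSo, (hU i).2.2.inter hSc⟩, fun c => ?_⟩
    constructor
    · rintro ⟨hc, hσ⟩
      obtain ⟨x, hx, hcx⟩ := (hWU c).mp hc
      have hxS : x ∈ ⋂ i ∈ σ, U i := by
        simp only [Set.mem_iInter]
        exact fun i hi => (hcx i).mp (hσ hi)
      exact ⟨x, ⟨hx, hxS⟩, fun i => (hcx i).trans (and_iff_left hxS).symm⟩
    · rintro ⟨x, ⟨hx, hxS⟩, hcx⟩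
      have hcx' : ∀ i, i ∈ c ↔ x ∈ U i := fun i => (hcx i).trans (and_iff_left hxS)
      refine ⟨(hWU c).mpr ⟨x, hx, hcx'⟩, fun i hi => (hcx' i).mpr ?_⟩
      simp only [Set.mem_iInter] at hxS
      exact hxS i hi

/-! ### Simplicial complexes are convex codes -/

theorem sum_biUnion_le {ι α : Type*} [DecidableEq ι] [DecidableEq α] (s : Finset ι)
    (t : ι → Finset α) {f : α → ℝ} (hf : ∀ a, 0 ≤ f a) :
    ∑ a ∈ s.biUnion t, f a ≤ ∑ i ∈ s, ∑ a ∈ t i, f a := by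
  induction s using Finset.induction_on with
  | empty => simp
  | insert i s hi ih =>
    rw [Finset.biUnion_insert, Finset.sum_insert hi]
    have h := Finset.sum_union_inter (s₁ := t i) (s₂ := s.biUnion t) (f := f)
    have h0 := Finset.sum_nonneg (s := t i ∩ s.biUnion t) fun a _ => hf a
    linarith

/-- A simplicial complex, with its empty face, is a convex code: in the open orthant with one axis for
each face, let `U i` consist of the points whose mass on the faces without `i` is small. -/
theorem isConvex_of_isSimplicialComplex {n : ℕ} {Δ : Set (Finset (Fin n))}
    (hΔ : IsSimplicialComplex Δ) : (CombCode.mk n Δ).IsConvex := by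
  classical
  set d := Fintype.card Δ
  let e : Fin d ≃ Δ := (Fintype.equivFin Δ).symm
  have hd0 : 0 < d := Fintype.card_pos_iff.mpr ⟨⟨∅, hΔ.1⟩⟩
  let S : Fin n → Finset (Fin d) := fun i => Finset.univ.filter fun a => i ∉ (e a).1
  -- `ℓ i x < 0` says that the faces without `i` carry less than `1 / (n + 1)` of the total mass.
  let ℓ : Fin n → EuclideanSpace ℝ (Fin d) →ₗ[ℝ] ℝ := fun i =>
    (n + 1 : ℝ) • ∑ a ∈ S i, (EuclideanSpace.proj a : EuclideanSpace ℝ (Fin d) →L[ℝ] ℝ).toLinearMap -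
      ∑ a, (EuclideanSpace.proj a : EuclideanSpace ℝ (Fin d) →L[ℝ] ℝ).toLinearMap
  have hℓ : ∀ i x, ℓ i x = (n + 1 : ℝ) * ∑ a ∈ S i, x a - ∑ a, x a := by
    intro i x
    simp [ℓ, LinearMap.sum_apply]
  let X : Set (EuclideanSpace ℝ (Fin d)) := {x | ∀ a, 0 < x a}
  have hXo : IsOpen X := by
    simp only [X, Set.ofPred_forall]
    exact isOpen_iInter_of_finite fun a => isOpen_lt continuous_const (by fun_prop)
  have hXc : Convex ℝ X := by
    intro x hx y hy s t hs ht hst a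
    have h1 := hx a
    have h2 := hy a
    simp only [PiLp.add_apply, PiLp.smul_apply, smul_eq_mul]
    rcases hs.eq_or_lt with rfl | hs
    · have : t = 1 := by linarith
      subst this
      simpa using h2
    · have := mul_pos hs h1
      have := mul_nonneg ht h2.le
      linarith
  refine isConvex_mk_iff.mpr ⟨d, X, fun i => X ∩ {x | ℓ i x < 0}, hXo, hXc, fun i =>
    ⟨Set.inter_subset_left, hXo.inter (isOpen_lt (ℓ i).continuous_of_finiteDimensional
      continuous_const), hXc.inter (convex_halfSpace_lt (ℓ i).isLinear 0)⟩, fun σ => ?_⟩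
  constructor
  · intro hσ
    set b := e.symm ⟨σ, hσ⟩ with hb
    have heb : (e b).1 = σ := by simp [hb]
    -- Extra mass on `σ`, chosen so that `(n + 1) * d < d + M`: the at most `d` unit masses
    -- elsewhere become negligible.
    set M : ℝ := (n + 1) * d with hM
    have hd1 : (1 : ℝ) ≤ d := by exact_mod_cast hd0
    have hn0 : (0 : ℝ) ≤ n := Nat.cast_nonneg n
    let x : EuclideanSpace ℝ (Fin d) := WithLp.toLp 2 fun a => if a = b then 1 + M else 1
    have hx1 : ∀ a, 1 ≤ x a := by
      intro a
      by_cases h : a = b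
      · simp [x, h, hM]; positivity
      · simp [x, h]
    have hxX : x ∈ X := fun a => lt_of_lt_of_le one_pos (hx1 a)
    have htot : ∑ a, x a = d + M := by
      have : ∀ a, x a = 1 + if a = b then M else 0 := by
        intro a
        by_cases h : a = b <;> simp [x, h]
      simp [this, Finset.sum_add_distrib]
    refine ⟨x, hxX, fun i => ?_⟩
    simp only [Set.mem_inter_iff, hxX, true_and, Set.mem_ofPred_eq, hℓ, htot]
    constructor
    · intro hi
      have : ∑ a ∈ S i, x a ≤ d := by
        calc ∑ a ∈ S i, x a = ∑ a ∈ S i, (1 : ℝ) := by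
              refine Finset.sum_congr rfl fun a ha => ?_
              have : a ≠ b := by
                rintro rfl
                simp only [S, Finset.mem_filter, heb] at ha
                exact ha.2 hi
              simp [x, this]
          _ = ((S i).card : ℝ) := by simp
          _ ≤ d := by exact_mod_cast (Finset.card_le_univ _).trans (by simp)
      nlinarith
    · intro h
      by_contra hi
      have hbS : b ∈ S i := by simp [S, heb, hi]
      have : 1 + M ≤ ∑ a ∈ S i, x a := by
        calc 1 + M = x b := by simp [x]
          _ ≤ _ := Finset.single_le_sum (f := fun a => x a) (fun a _ => (hxX a).le) hbS
      have hn1 : (1 : ℝ) ≤ n := by exact_mod_cast i.pos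
      have h1 := mul_le_mul_of_nonneg_left this (by positivity : (0 : ℝ) ≤ n + 1)
      have hdM : (d : ℝ) ≤ M := by nlinarith
      have h2 : M ≤ n * M := le_mul_of_one_le_left (by linarith) hn1
      linarith
  · rintro ⟨x, hxX, hx⟩
    have hx' : ∀ i ∈ σ, (n + 1 : ℝ) * ∑ a ∈ S i, x a < ∑ a, x a := by
      intro i hi
      have := ((hx i).mp hi).2
      simp only [Set.mem_ofPred_eq, hℓ] at this
      linarith
    have hpos : 0 < ∑ a, x a :=
      Finset.sum_pos (fun a _ => hxX a) ⟨⟨0, hd0⟩, Finset.mem_univ _⟩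
    by_contra hσ
    -- Each face misses some vertex of a non-face `σ`, so at most `n` parts, each below `1 / (n +
    -- 1)` of the mass, would cover all of it.
    have hcov : (Finset.univ : Finset (Fin d)) ⊆ σ.biUnion S := by
      intro a _
      have : ¬ σ ⊆ (e a).1 := fun h => hσ (hΔ.2 h (e a).2)
      obtain ⟨i, hi, hia⟩ := Finset.not_subset.mp this
      exact Finset.mem_biUnion.mpr ⟨i, hi, by simp [S, hia]⟩
    have h1 : ∑ a, x a ≤ ∑ i ∈ σ, ∑ a ∈ S i, x a :=
      (Finset.sum_le_sum_of_subset_of_nonneg hcov fun a _ _ => (hxX a).le).trans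
        (sum_biUnion_le σ S (fun a => (hxX a).le))
    have h2 : (n + 1 : ℝ) * ∑ i ∈ σ, ∑ a ∈ S i, x a ≤ n * ∑ a, x a := by
      rw [Finset.mul_sum]
      calc ∑ i ∈ σ, (n + 1 : ℝ) * ∑ a ∈ S i, x a ≤ ∑ i ∈ σ, ∑ a, x a :=
            Finset.sum_le_sum fun i hi => (hx' i hi).le
        _ = σ.card * ∑ a, x a := by simp
        _ ≤ n * ∑ a, x a := by
            gcongr
            exact_mod_cast (Finset.card_le_univ σ).trans (by simp)
    have hn0 : (0 : ℝ) ≤ n := Nat.cast_nonneg n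
    nlinarith

/-! ### Minimal non-convexity -/

theorem not_isConvex_of_not_isCollapsible {n : ℕ} {Δ : Set (Finset (Fin n))}
    (hΔ : IsSimplicialComplex Δ) (hne : Δ ≠ {∅}) (hnc : ¬ IsCollapsible Δ) :
    ¬ (CombCode.mk n (Δ \ {∅})).IsConvex := by
  classical
  intro h
  obtain ⟨d, X, U, hXo, hXc, hU, hWU⟩ := isConvex_mk_iff.mp h
  have hcode : ∀ x ∈ X, ∃ σ, σ ∈ Δ \ {∅} ∧ ∀ i, i ∈ σ ↔ x ∈ U i := by
    intro x hx
    have hσ : ∀ i, i ∈ Finset.univ.filter (fun i => x ∈ U i) ↔ x ∈ U i := by simp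
    exact ⟨_, (hWU _).mpr ⟨x, hx, hσ⟩, hσ⟩
  have hXne : X.Nonempty := by
    obtain ⟨σ, hσ, h0⟩ : ∃ σ ∈ Δ, σ ≠ ∅ := by
      by_contra! h
      exact hne (Set.eq_singleton_iff_unique_mem.mpr ⟨hΔ.1, h⟩)
    obtain ⟨x, hx, -⟩ := (hWU σ).mp ⟨hσ, h0⟩
    exact ⟨x, hx⟩
  refine hnc ?_
  have hEq : Δ = {F | (X ∩ ⋂ i ∈ F, U i).Nonempty} := by
    ext F
    constructor
    · intro hF
      rcases F.eq_empty_or_nonempty with rfl | hF0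
      · simpa using hXne
      · obtain ⟨x, hx, hFx⟩ := (hWU F).mp ⟨hF, hF0.ne_empty⟩
        refine ⟨x, hx, ?_⟩
        simp only [Set.mem_iInter]
        exact fun i hi => (hFx i).mp hi
    · rintro ⟨x, hx, hFx⟩
      obtain ⟨σ, hσ, hσx⟩ := hcode x hx
      simp only [Set.mem_iInter] at hFx
      exact hΔ.2 (fun i hi => (hσx i).mpr (hFx i hi)) hσ.1
  rw [hEq]
  refine isCollapsible_nerve hXc hXne (fun i => (hU i).2.1) (fun i => (hU i).2.2) ?_
  intro x hx
  obtain ⟨σ, hσ, hσx⟩ := hcode x hx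
  obtain ⟨i, hi⟩ := Finset.nonempty_iff_ne_empty.mpr hσ.2
  exact Set.mem_iUnion.mpr ⟨i, (hσx i).mp hi⟩

/-- A morphism for which the trunk of each neuron is a preimage is an isomorphism onto its image. -/
theorem isomorphic_image {C D : CombCode} {f : C.words → D.words} (hf : IsMorphism f)
    (h : ∀ c ∈ C.words, ∀ v ∈ c, ∃ j, ∀ c : C.words, j ∈ (f c).1 ↔ v ∈ c.1) :
    Isomorphic (image f) C := by
  classical
  have hinj : Function.Injective fun c => (f c).1 := by
    intro c c' hcc
    ext v
    constructor
    · intro hv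
      replace hcc : (f c).1 = (f c').1 := hcc
      obtain ⟨j, hj⟩ := h c.1 c.2 v hv
      rw [← hj c']
      exact hcc ▸ (hj c).mpr hv
    · intro hv
      replace hcc : (f c).1 = (f c').1 := hcc
      obtain ⟨j, hj⟩ := h c'.1 c'.2 v hv
      rw [← hj c]
      exact hcc ▸ (hj c').mpr hv
  let F : C.words → (image f).words := fun c => ⟨(f c).1, c, rfl⟩
  have hG : ∀ e : (image f).words, ∃ c, F c = e := by
    rintro ⟨_, c, rfl⟩
    exact ⟨c, rfl⟩
  choose G hG using hG
  have hGF : Function.LeftInverse G F := fun c => by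
    have h : (F (G (F c))).1 = (F c).1 := by rw [hG]
    exact hinj h
  have hF : ∀ j : Fin D.n, (∀ c, j ∉ (f c).1) ∨
      ∃ τ : Finset (Fin C.n), ∀ c, j ∈ (f c).1 ↔ τ ⊆ c.1 := isMorphism_iff.mp hf
  refine ⟨G, F, isMorphism_iff.mpr fun v => ?_, isMorphism_iff.mpr hF, hG, hGF⟩
  by_cases hv : ∃ c ∈ C.words, v ∈ c
  · obtain ⟨c, hc, hvc⟩ := hv
    obtain ⟨j, hj⟩ := h c hc v hvc
    right
    refine ⟨{j}, fun e => ?_⟩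
    conv_rhs => rw [← hG e]
    exact (hj (G e)).symm.trans Finset.singleton_subset_iff.symm
  · left
    exact fun e he => hv ⟨_, (G e).2, he⟩

theorem minimallyNonConvex_of_not_isCollapsible {n : ℕ} {Δ : Set (Finset (Fin n))}
    (hΔ : IsSimplicialComplex Δ) (hne : Δ ≠ {∅}) (hnc : ¬ IsCollapsible Δ) :
    (CombCode.mk n (Δ \ {∅})).MinimallyNonConvex := by
  classical
  refine ⟨not_isConvex_of_not_isCollapsible hΔ hne hnc, ?_, ?_⟩
  · intro D f hf hiso
    have hv : ∃ c ∈ Δ \ {∅}, ∃ v ∈ c, ∀ j, ¬ ∀ c : (CombCode.mk n (Δ \ {∅})).words,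
        j ∈ (f c).1 ↔ v ∈ c.1 := by
      by_contra! h
      exact hiso (isomorphic_image hf h)
    obtain ⟨c, hc, v, hvc, hv⟩ := hv
    have hvΔ : {v} ∈ Δ \ {∅} := ⟨hΔ.2 (Finset.singleton_subset_iff.mpr hvc) hc.1, by simp⟩
    -- The value at `∅` copies that at `{v}`. No neuron of `D` has exactly the trunk of `v` as
    -- preimage, so each defining `τ` differs from `{v}`, and then `τ ⊆ {v}` iff `τ ⊆ ∅`.
    set g : Finset (Fin n) → Finset (Fin D.n) := fun c =>
      if h : c ∈ Δ \ {∅} then (f ⟨c, h⟩).1 else (f ⟨{v}, hvΔ⟩).1 with hgdef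
    have hgf : ∀ c (h : c ∈ Δ \ {∅}), g c = (f ⟨c, h⟩).1 := fun c h => dif_pos h
    have hg0 : g ∅ = (f ⟨{v}, hvΔ⟩).1 := dif_neg (by simp)
    have hmem : ∀ c ∈ Δ, c = ∅ ∨ c ∈ Δ \ {∅} := fun c hc =>
      (em (c = ∅)).imp_right fun h => ⟨hc, h⟩
    have hW : CombCode.image f = ⟨D.n, g '' Δ⟩ := by
      unfold CombCode.image
      congr 1
      ext σ
      constructor
      · rintro ⟨c, rfl⟩
        exact ⟨c.1, c.2.1, hgf _ c.2⟩
      · rintro ⟨c, hc, rfl⟩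
        rcases hmem c hc with rfl | hc
        · exact ⟨_, hg0.symm⟩
        · exact ⟨⟨c, hc⟩, (hgf c hc).symm⟩
    rw [hW]
    refine (isConvex_of_isSimplicialComplex hΔ).map g fun j =>
      (isMorphism_iff.mp hf j).imp ?_ ?_
    · intro h c hc
      rcases hmem c hc with rfl | hc
      · rw [hg0]; exact h _
      · rw [hgf c hc]; exact h _
    · rintro ⟨τ, h⟩
      have hτ : τ ≠ {v} := by
        rintro rfl
        exact hv j fun c => (h c).trans Finset.singleton_subset_iff
      refine ⟨τ, fun c hc => ?_⟩
      rcases hmem c hc with rfl | hc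
      · rw [hg0, h, Finset.subset_empty]
        exact ⟨fun h => (Finset.subset_singleton_iff.mp h).resolve_right hτ,
          fun h => by rw [h]; exact Finset.empty_subset _⟩
      · rw [hgf c hc]
        exact h ⟨c, hc⟩
  · rintro T (rfl | ⟨σ, rfl⟩) hT
    · exact isConvex_empty _
    · have hσ : σ ≠ ∅ := by
        rintro rfl
        exact hT (by ext c; simp [trunk])
      refine (isConvex_of_isSimplicialComplex hΔ).isTrunk (Or.inr ⟨σ, ?_⟩)
      ext c
      constructor
      · rintro ⟨hc, hs⟩
        exact ⟨hc.1, hs⟩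
      · rintro ⟨hc, hs⟩
        refine ⟨⟨hc, ?_⟩, hs⟩
        rintro rfl
        exact hσ (Finset.subset_empty.mp hs)

/-! ### The order on codes -/

theorem IsConvex.operation {C D : CombCode} (hC : C.IsConvex) (h : Operation C D) :
    D.IsConvex := by
  rcases h with ⟨E, f, hf, rfl⟩ | ⟨T, hT, rfl⟩
  · exact hC.image hf
  · exact hC.isTrunk hT

theorem Isomorphic.refl (C : CombCode) : Isomorphic C C := by
  have hid : IsMorphism (id : C.words → C.words) :=
    isMorphism_iff.mpr fun j => Or.inr ⟨{j}, fun c => Finset.singleton_subset_iff.symm⟩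
  exact ⟨id, id, hid, hid, fun _ => rfl, fun _ => rfl⟩

/-- A non-convex code obtained by one operation from a copy of a minimally non-convex code is again a
copy of it. -/
theorem MinimallyNonConvex.isomorphic_of_operation {C C' D : CombCode} (hC : C.MinimallyNonConvex)
    (hiso : Isomorphic C' C) (hop : Operation C' D) (hD : ¬ D.IsConvex) : Isomorphic D C := by
  obtain ⟨f, g, hf, hg, hgf, hfg⟩ := hiso
  rcases hop with ⟨E, φ, hφ, rfl⟩ | ⟨T, hT, rfl⟩
  · have himg : image (φ ∘ g) = image φ := by
      unfold image
      congr 1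
      ext σ
      constructor
      · rintro ⟨c, rfl⟩
        exact ⟨g c, rfl⟩
      · rintro ⟨c, rfl⟩
        exact ⟨f c, congrArg (fun c => (φ c).1) (hgf c)⟩
    rw [← himg] at hD ⊢
    by_contra h
    exact hD (hC.2.1 E _ (hφ.comp hg) h)
  · by_cases hTw : T = C'.words
    · rw [hTw]
      exact ⟨f, g, hf, hg, hgf, hfg⟩
    · exfalso
      -- The copy of `T` in `C` is a proper trunk, hence convex, and `g` carries it onto `T`.
      set T' : Set (Finset (Fin C.n)) := Subtype.val '' {c : C.words | (g c).1 ∈ T} with hT'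
      have hT't : C.IsTrunk T' := hg T hT
      have hTsub : T ⊆ C'.words := by
        rcases hT with rfl | ⟨σ, rfl⟩
        · exact Set.empty_subset _
        · exact fun c hc => hc.1
      have hT'w : ∀ c ∈ T', ∃ h : c ∈ C.words, (g ⟨c, h⟩).1 ∈ T := by
        rintro _ ⟨c, hc, rfl⟩
        exact ⟨c.2, hc⟩
      have hconv : (CombCode.mk C.n T').IsConvex := by
        refine hC.2.2 T' hT't fun h => hTw (hTsub.antisymm fun c hc => ?_)
        obtain ⟨_, hm⟩ := hT'w (f ⟨c, hc⟩).1 (by rw [h]; exact (f ⟨c, hc⟩).2)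
        have := hgf ⟨c, hc⟩
        simp only [Subtype.coe_eta, this] at hm
        exact hm
      let ψ : (CombCode.mk C.n T').words → C'.words := fun c => g ⟨c.1, (hT'w c.1 c.2).1⟩
      have hψ : IsMorphism ψ := by
        refine isMorphism_iff.mpr fun j => (isMorphism_iff.mp hg j).imp ?_ ?_
        · exact fun h c => h _
        · rintro ⟨τ, h⟩
          exact ⟨τ, fun c => h ⟨c.1, _⟩⟩
      have himg : image ψ = ⟨C'.n, T⟩ := by
        unfold image
        congr 1
        ext σ
        constructor
        · rintro ⟨c, rfl⟩
          exact (hT'w c.1 c.2).2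
        · intro hσ
          have hgσ : g (f ⟨σ, hTsub hσ⟩) = ⟨σ, hTsub hσ⟩ := hgf _
          refine ⟨⟨(f ⟨σ, hTsub hσ⟩).1, f ⟨σ, hTsub hσ⟩, ?_, rfl⟩, ?_⟩
          · rw [Set.mem_ofPred_eq, hgσ]
            exact hσ
          · exact congrArg Subtype.val hgσ
      exact hD (himg ▸ hconv.image hψ)

/-- Operations preserve convexity, so every code on the way to a non-convex `D` is non-convex, and
each step stays within the isomorphism class of `C`. -/
theorem MinimallyNonConvex.isomorphic_of_below {C D : CombCode} (hC : C.MinimallyNonConvex)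
    (h : Below D C) (hD : ¬ D.IsConvex) : Isomorphic D C := by
  induction h with
  | refl => exact Isomorphic.refl C
  | tail _ hstep ih =>
    exact hC.isomorphic_of_operation (ih fun hc => hD (hc.operation hstep)) hstep hD

theorem Isomorphic.card_eq {C D : CombCode} (h : Isomorphic C D) :
    Nat.card C.words = Nat.card D.words := by
  obtain ⟨f, g, -, -, hgf, hfg⟩ := h
  exact Nat.card_congr ⟨f, g, hgf, hfg⟩

end CombCode

/-! ### Boundaries of simplices -/

section SimplexBoundary

/-- The boundary complex of the simplex on `n` vertices. -/
def simplexBoundary (n : ℕ) : Set (Finset (Fin n)) := {σ | σ ≠ Finset.univ}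

theorem isSimplicialComplex_simplexBoundary (n : ℕ) :
    IsSimplicialComplex (simplexBoundary (n + 1)) := by
  refine ⟨fun h => ?_, fun a b hba ha hb => ha ?_⟩
  · exact Finset.univ_nonempty.ne_empty h.symm
  · exact Finset.univ_subset_iff.mp (hb ▸ hba)

theorem singleton_mem_simplexBoundary {n : ℕ} (i : Fin (n + 2)) :
    {i} ∈ simplexBoundary (n + 2) := by
  intro h
  have := congrArg Finset.card h
  simp at this

theorem simplexBoundary_ne (n : ℕ) : simplexBoundary (n + 2) ≠ {∅} := by
  intro h
  have := singleton_mem_simplexBoundary (0 : Fin (n + 2))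
  rw [h] at this
  simp at this

/-- The boundary of a simplex has no free face. -/
theorem not_collapseStep_simplexBoundary (n : ℕ) (Γ : Set (Finset (Fin n))) :
    ¬ CollapseStep (simplexBoundary n) Γ := by
  rintro ⟨τ, σ, -, hτσ, hσ, hfree, -⟩
  obtain ⟨j, hj⟩ : ∃ j, j ∉ σ := by
    by_contra! h
    exact hσ (Finset.eq_univ_iff_forall.mpr h)
  obtain ⟨i, hi, hiτ⟩ := Finset.exists_of_ssubset hτσ
  -- `insert j τ` misses `i`, so it is a face above `τ` that is not inside `σ`.
  refine hj (hfree (insert j τ) (fun h => ?_) (Finset.subset_insert _ _)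
    (Finset.mem_insert_self _ _))
  have : i ∈ insert j τ := h ▸ Finset.mem_univ i
  rcases Finset.mem_insert.mp this with rfl | h
  · exact hj hi
  · exact hiτ h

theorem not_isCollapsible_simplexBoundary (n : ℕ) : ¬ IsCollapsible (simplexBoundary (n + 2)) := by
  rintro ⟨v, h⟩
  rcases h.cases_head with h | ⟨Γ, h, -⟩
  · have hv : ∀ i : Fin (n + 2), i = v := fun i => by
      have := singleton_mem_simplexBoundary i
      rw [h] at this
      simpa using this
    exact absurd ((hv 0).trans (hv 1).symm) (by simp)
  · exact not_collapseStep_simplexBoundary _ _ h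

theorem card_simplexBoundary_diff (n : ℕ) :
    Nat.card (simplexBoundary (n + 1) \ {∅} : Set (Finset (Fin (n + 1)))) = 2 ^ (n + 1) - 2 := by
  have : (simplexBoundary (n + 1) \ {∅} : Set (Finset (Fin (n + 1)))) =
      ((Finset.univ.erase Finset.univ).erase ∅ : Finset (Finset (Fin (n + 1)))) := by
    ext σ
    simp [simplexBoundary, and_comm]
  rw [this, Nat.card_coe_set_eq, Set.ncard_coe_finset, Finset.card_erase_of_mem,
    Finset.card_erase_of_mem (Finset.mem_univ _)]
  · simp [Nat.sub_sub]
  · simp only [Finset.mem_erase, Finset.mem_univ, and_true]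
    exact fun h => Finset.univ_nonempty.ne_empty h.symm

end SimplexBoundary

theorem proposition4 :
    (∀ (n : ℕ) (Δ : Set (Finset (Fin n))), IsSimplicialComplex Δ → Δ ≠ {∅} → ¬ IsCollapsible Δ →
      (CombCode.mk n (Δ \ {∅})).MinimallyNonConvex) ∧
    (∃ S : Set CombCode, S.Infinite ∧ IsAntichain CombCode.Below S ∧
      ∀ C ∈ S, C.MinimallyNonConvex ∧
        ∃ (n : ℕ) (Δ : Set (Finset (Fin n))), IsSimplicialComplex Δ ∧ Δ ≠ {∅} ∧
          ¬ IsCollapsible Δ ∧ C = CombCode.mk n (Δ \ {∅})) := by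
  have hmin : ∀ (n : ℕ) (Δ : Set (Finset (Fin n))), IsSimplicialComplex Δ → Δ ≠ {∅} →
      ¬ IsCollapsible Δ → (CombCode.mk n (Δ \ {∅})).MinimallyNonConvex :=
    fun n Δ => CombCode.minimallyNonConvex_of_not_isCollapsible
  refine ⟨hmin, ?_⟩
  -- Two vertices are the least number: the boundary of a single vertex is `{∅}`.
  let B : ℕ → CombCode := fun n => ⟨n + 2, simplexBoundary (n + 2) \ {∅}⟩
  have hB : ∀ n, (B n).MinimallyNonConvex := fun n => hmin _ _
    (isSimplicialComplex_simplexBoundary _) (simplexBoundary_ne n)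
    (not_isCollapsible_simplexBoundary n)
  refine ⟨Set.range B, Set.infinite_range_of_injective fun a b h => ?_, ?_, ?_⟩
  · have := congrArg CombCode.n h
    simpa [B] using this
  · rintro _ ⟨a, rfl⟩ _ ⟨b, rfl⟩ hab h
    have hcard := ((hB b).isomorphic_of_below h (hB a).1).card_eq
    have hcard' : 2 ^ (a + 2) - 2 = 2 ^ (b + 2) - 2 := by
      rw [← card_simplexBoundary_diff (a + 1), ← card_simplexBoundary_diff (b + 1)]
      exact hcard
    have ha : 2 ≤ 2 ^ (a + 2) := Nat.le_self_pow (by omega) 2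
    have hb : 2 ≤ 2 ^ (b + 2) := Nat.le_self_pow (by omega) 2
    have hpow : 2 ^ (a + 2) = 2 ^ (b + 2) := by omega
    have := Nat.pow_right_injective le_rfl hpow
    exact hab (by rw [show a = b by omega])
  · rintro _ ⟨n, rfl⟩
    exact ⟨hB n, n + 2, simplexBoundary (n + 2), isSimplicialComplex_simplexBoundary _,
      simplexBoundary_ne n, not_isCollapsible_simplexBoundary n, rfl⟩
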